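/- Corollary 5.2. Let $\alpha>0$, $\lambda\in\mathbb{R}$ and $p\ge 1$ be real numbers. There are positive constants $c_1, C_1, c_2, C_2$, depending only on $\alpha$, $\lambda$ and $p$, such that for every real sequence $\{a_\nu\}_{\nu=1}^\infty$ with $a_\nu\ge 0$ and $a_{\nu+1}\le a_\nu$ for all $\nu\ge 1$, and for every positive integer $n$, $$c_1\sum_{\mu=1}^n \mu^{\alpha-1}\left(a_\mu\mu^{\lambda+1}\right)^p \;\le\; \sum_{\mu=1}^n \mu^{\alpha-1}\left(\sum_{\nu=\mu}^n a_\nu\nu^\lambda\right)^p \;\le\; C_1\sum_{\mu=1}^n \mu^{\alpha-1}\left(a_\mu\mu^{\lambda+1}\right)^p$$ and $$c_2\sum_{\mu=1}^n \mu^{-\alpha-1}\left(a_\mu\mu^{\lambda+1}\right)^p \;\le\; \sum_{\mu=1}^n \mu^{-\alpha-1}\left(\sum_{\nu=1}^\mu a_\nu\nu^\lambda\right)^p \;\le\; C_2\sum_{\mu=1}^n \mu^{-\alpha-1}\left(a_\mu\mu^{\lambda+1}\right)^p .$$ -/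

import Mathlib

/-- The real sequence `a 1, a 2, a 3, …` is non-negative and monotone decreasing
(in the wide sense). The value `a 0` is not part of the sequence and is unrestricted. -/
def NonnegDecreasing (a : ℕ → ℝ) : Prop :=
  ∀ ν : ℕ, 1 ≤ ν → 0 ≤ a ν ∧ a (ν + 1) ≤ a ν

open Finset

/-! The upper bounds are discrete weighted Hardy inequalities (`hardy_tail`, `hardy_initial`) for `b
k = a k * k ^ lam`; they need only `b ≥ 0`. Both follow from Schur's test with power weights, which
reduces them to two power-sum estimates.

The lower bounds use monotonicity: on the block from ⌈m/2⌉ to m every `a k` is at least `a m` and `k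
^ lam` is comparable to `m ^ lam`, so the block sum dominates `a m * m ^ (lam + 1)`. For initial
sums the block lies in [1, m] and terms compare index by index. For tails it lies in [⌈m/2⌉, n], so
term m is compared with term ⌈m/2⌉, and each index is used at most twice. -/

/-! ### Power sums -/

/-- A Bernoulli-type bound valid for every positive exponent. -/
lemma one_sub_inv_rpow_le {δ m : ℝ} (hδ : 0 < δ) (hm : 1 ≤ m) :
    (1 - 1 / m) ^ δ ≤ 1 - δ / (1 + δ) / m := by
  have hm0 : 0 < m := by linarith
  have h0 : 0 ≤ 1 - 1 / m := by
    rw [sub_nonneg, div_le_one hm0]; exact hm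
  have h1 : 1 - 1 / m ≤ Real.exp (-(1 / m)) := by
    have := Real.add_one_le_exp (-(1 / m)); linarith
  have h2 : (1 - 1 / m) ^ δ ≤ Real.exp (-(δ / m)) := by
    calc (1 - 1 / m) ^ δ ≤ (Real.exp (-(1 / m))) ^ δ := Real.rpow_le_rpow h0 h1 hδ.le
      _ = Real.exp (-(δ / m)) := by rw [← Real.exp_mul]; congr 1; ring
  have h3 : Real.exp (-(δ / m)) ≤ 1 / (1 + δ / m) := by
    rw [Real.exp_neg, ← one_div]
    apply one_div_le_one_div_of_le (by positivity)
    have := Real.add_one_le_exp (δ / m); linarith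
  -- The gap from 1 is δ / (m + δ), and m + δ ≤ m (1 + δ) since m ≥ 1.
  have h4 : 1 / (1 + δ / m) ≤ 1 - δ / (1 + δ) / m := by
    have : 1 - δ / (1 + δ) / m - 1 / (1 + δ / m)
        = δ ^ 2 * (m - 1) / (m * (1 + δ) * (m + δ)) := by
      field_simp; ring
    have h5 : 0 ≤ δ ^ 2 * (m - 1) / (m * (1 + δ) * (m + δ)) := by
      have : 0 ≤ m - 1 := by linarith
      positivity
    linarith
  linarith

/-- Partial sums of `∑ k ^ (δ - 1)` grow at most like `n ^ δ`. -/
lemma sum_Icc_one_rpow_le {δ : ℝ} (hδ : 0 < δ) (n : ℕ) :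
    ∑ k ∈ Icc 1 n, (k : ℝ) ^ (δ - 1) ≤ (1 + δ) / δ * (n : ℝ) ^ δ := by
  induction n with
  | zero => simp [Real.zero_rpow hδ.ne']
  | succ n ih =>
    rw [sum_Icc_succ_top (by omega)]
    have hm : (1 : ℝ) ≤ (n + 1 : ℕ) := by push_cast; linarith [n.cast_nonneg (α := ℝ)]
    have hm0 : (0 : ℝ) < (n + 1 : ℕ) := by linarith
    have hb := one_sub_inv_rpow_le hδ hm
    have hn : (n : ℝ) = (n + 1 : ℕ) * (1 - 1 / (n + 1 : ℕ)) := by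
      field_simp; push_cast; ring
    have h0 : (0 : ℝ) ≤ 1 - 1 / (n + 1 : ℕ) := by
      rw [sub_nonneg, div_le_one hm0]; exact hm
    have hs : (n : ℝ) ^ δ ≤ ((n + 1 : ℕ) : ℝ) ^ δ
        - δ / (1 + δ) * ((n + 1 : ℕ) : ℝ) ^ (δ - 1) := by
      calc (n : ℝ) ^ δ = ((n + 1 : ℕ) : ℝ) ^ δ * (1 - 1 / (n + 1 : ℕ)) ^ δ := by
            conv_lhs => rw [hn]
            exact Real.mul_rpow hm0.le h0
        _ ≤ ((n + 1 : ℕ) : ℝ) ^ δ * (1 - δ / (1 + δ) / (n + 1 : ℕ)) := by gcongr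
        _ = _ := by rw [Real.rpow_sub_one hm0.ne']; ring
    calc _ ≤ (1 + δ) / δ * (n : ℝ) ^ δ + ((n + 1 : ℕ) : ℝ) ^ (δ - 1) := by gcongr
      _ ≤ (1 + δ) / δ * (((n + 1 : ℕ) : ℝ) ^ δ - δ / (1 + δ) * ((n + 1 : ℕ) : ℝ) ^ (δ - 1))
          + ((n + 1 : ℕ) : ℝ) ^ (δ - 1) := by gcongr
      _ = _ := by field_simp; ring

/-- The Bernoulli bound at k + 1 makes the summand a telescoping difference; the factor 2 absorbs k
+ 1 ≤ 2k. -/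
lemma rpow_neg_succ_step {δ : ℝ} (hδ : 0 < δ) {k : ℕ} (hk : 1 ≤ k) :
    (k : ℝ) ^ (-1 - δ) ≤
      2 * ((1 + δ) / δ) * ((k : ℝ) ^ (-δ) - ((k + 1 : ℕ) : ℝ) ^ (-δ)) := by
  have hk1 : (1 : ℝ) ≤ k := by exact_mod_cast hk
  have hk0 : (0 : ℝ) < k := by linarith
  have hm : (1 : ℝ) ≤ (k + 1 : ℝ) := by linarith
  have hb := one_sub_inv_rpow_le hδ hm
  have he : (1 - 1 / ((k : ℝ) + 1)) = k / (k + 1) := by field_simp; ring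
  rw [he, Real.div_rpow hk0.le (by linarith)] at hb
  have h1 : ((k + 1 : ℕ) : ℝ) ^ (-δ) = (k : ℝ) ^ (-δ) * ((k : ℝ) ^ δ / ((k : ℝ) + 1) ^ δ) := by
    push_cast
    rw [Real.rpow_neg hk0.le, Real.rpow_neg (by linarith)]
    have : (k : ℝ) ^ δ ≠ 0 := (Real.rpow_pos_of_pos hk0 _).ne'
    field_simp
  have h2 : (k : ℝ) ^ (-1 - δ) = (k : ℝ) ^ (-δ) * (1 / k) := by
    rw [show -1 - δ = -δ - 1 by ring, Real.rpow_sub_one hk0.ne']; ring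
  have h3 : 1 / (k : ℝ) ≤ 2 * ((1 + δ) / δ) * (δ / (1 + δ) / (k + 1)) := by
    have : 2 * ((1 + δ) / δ) * (δ / (1 + δ) / ((k : ℝ) + 1)) = 2 / (k + 1) := by
      field_simp
    rw [this, div_le_div_iff₀ hk0 (by linarith)]; linarith
  rw [h1, h2]
  calc (k : ℝ) ^ (-δ) * (1 / k)
      ≤ (k : ℝ) ^ (-δ) * (2 * ((1 + δ) / δ) * (δ / (1 + δ) / (k + 1))) := by gcongr
    _ ≤ (k : ℝ) ^ (-δ) * (2 * ((1 + δ) / δ) * (1 - (k : ℝ) ^ δ / ((k : ℝ) + 1) ^ δ)) := by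
        gcongr; linarith
    _ = _ := by ring

/-- Tails of `∑ k ^ (-1 - δ)` decay at least like `m ^ (-δ)`. -/
lemma sum_Icc_rpow_neg_le {δ : ℝ} (hδ : 0 < δ) {m : ℕ} (hm : 1 ≤ m) (n : ℕ) :
    ∑ k ∈ Icc m n, (k : ℝ) ^ (-1 - δ) ≤ 2 * ((1 + δ) / δ) * (m : ℝ) ^ (-δ) := by
  rcases lt_or_ge n m with h | h
  · rw [Icc_eq_empty (by omega), sum_empty]; positivity
  -- The subtracted end term is what lets the induction close by telescoping.
  · have key : ∑ k ∈ Icc m n, (k : ℝ) ^ (-1 - δ) ≤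
        2 * ((1 + δ) / δ) * ((m : ℝ) ^ (-δ) - ((n + 1 : ℕ) : ℝ) ^ (-δ)) := by
      induction n, h using Nat.le_induction with
      | base => rw [Icc_self, sum_singleton]; exact rpow_neg_succ_step hδ hm
      | succ n hn ih =>
        rw [sum_Icc_succ_top (by omega)]
        have := rpow_neg_succ_step hδ (k := n + 1) (by omega)
        linarith
    refine key.trans ?_
    gcongr
    have : 0 ≤ ((n + 1 : ℕ) : ℝ) ^ (-δ) := by positivity
    linarith

/-! ### Hardy inequalities -/

/-- Schur's test for a `0`-`1` kernel `R`, with weights `x`, `y`. -/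
lemma sum_mul_sum_filter_rpow_le {ι : Type*} [DecidableEq ι] (s : Finset ι) (R : ι → ι → Prop)
    [∀ i j, Decidable (R i j)] {p : ℝ} (hp : 1 ≤ p) {x y f Y Z : ι → ℝ}
    (hx : ∀ i ∈ s, 0 ≤ x i) (hy : ∀ i ∈ s, 0 ≤ y i) (hf : ∀ i ∈ s, 0 ≤ f i)
    (hY : ∀ i ∈ s, ∑ j ∈ s with R i j, y j ≤ Y i)
    (hZ : ∀ j ∈ s, ∑ i ∈ s with R i j, x i * Y i ^ (p - 1) ≤ Z j) :
    ∑ i ∈ s, x i * (∑ j ∈ s with R i j, y j * f j) ^ p ≤ ∑ j ∈ s, Z j * (y j * f j ^ p) := by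
  have hp0 : 0 < p := by linarith
  have jensen : ∀ i ∈ s, (∑ j ∈ s with R i j, y j * f j) ^ p ≤
      Y i ^ (p - 1) * ∑ j ∈ s with R i j, y j * f j ^ p := by
    intro i hi
    -- Extension by zero: the weighted Hölder inequality applied below asks for nonnegativity at
    -- every index.
    let g : ι → ℝ := fun j => if j ∈ s then y j else 0
    let h : ι → ℝ := fun j => if j ∈ s then f j else 0
    have hg : ∀ j, 0 ≤ g j := fun j => by
      by_cases hj : j ∈ s <;> simp [g, hj, hy]
    have hh : ∀ j, 0 ≤ h j := fun j => by
      by_cases hj : j ∈ s <;> simp [h, hj, hf]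
    have H := Real.inner_le_weight_mul_Lp_of_nonneg (s.filter (R i)) hp g h hg hh
    have e1 : ∑ j ∈ s with R i j, g j * h j = ∑ j ∈ s with R i j, y j * f j :=
      sum_congr rfl fun j hj => by simp [g, h, (mem_filter.1 hj).1]
    have e2 : ∑ j ∈ s with R i j, g j = ∑ j ∈ s with R i j, y j :=
      sum_congr rfl fun j hj => by simp [g, (mem_filter.1 hj).1]
    have e3 : ∑ j ∈ s with R i j, g j * h j ^ p = ∑ j ∈ s with R i j, y j * f j ^ p :=
      sum_congr rfl fun j hj => by simp [g, h, (mem_filter.1 hj).1]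
    rw [e1, e2, e3] at H
    have n1 : 0 ≤ ∑ j ∈ s with R i j, y j * f j :=
      sum_nonneg fun j hj => mul_nonneg (hy j (mem_filter.1 hj).1) (hf j (mem_filter.1 hj).1)
    have n2 : 0 ≤ ∑ j ∈ s with R i j, y j := sum_nonneg fun j hj => hy j (mem_filter.1 hj).1
    have n3 : 0 ≤ ∑ j ∈ s with R i j, y j * f j ^ p :=
      sum_nonneg fun j hj => mul_nonneg (hy j (mem_filter.1 hj).1)
        (Real.rpow_nonneg (hf j (mem_filter.1 hj).1) _)
    calc _ ≤ ((∑ j ∈ s with R i j, y j) ^ (1 - p⁻¹) *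
          (∑ j ∈ s with R i j, y j * f j ^ p) ^ p⁻¹) ^ p := Real.rpow_le_rpow n1 H hp0.le
      _ = (∑ j ∈ s with R i j, y j) ^ (p - 1) * ∑ j ∈ s with R i j, y j * f j ^ p := by
          rw [Real.mul_rpow (by positivity) (by positivity), ← Real.rpow_mul n2,
            ← Real.rpow_mul n3, inv_mul_cancel₀ hp0.ne', Real.rpow_one, sub_mul,
            inv_mul_cancel₀ hp0.ne', one_mul]
      _ ≤ _ := mul_le_mul_of_nonneg_right
          (Real.rpow_le_rpow n2 (hY i hi) (by linarith)) n3
  calc _ ≤ ∑ i ∈ s, x i * (Y i ^ (p - 1) * ∑ j ∈ s with R i j, y j * f j ^ p) :=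
        sum_le_sum fun i hi => mul_le_mul_of_nonneg_left (jensen i hi) (hx i hi)
    _ = ∑ j ∈ s, (∑ i ∈ s with R i j, x i * Y i ^ (p - 1)) * (y j * f j ^ p) := by
        simp_rw [sum_filter, mul_sum, sum_mul]
        rw [sum_comm]
        refine sum_congr rfl fun j _ => sum_congr rfl fun i _ => ?_
        split_ifs <;> ring
    _ ≤ _ := sum_le_sum fun j hj => mul_le_mul_of_nonneg_right (hZ j hj)
        (mul_nonneg (hy j hj) (Real.rpow_nonneg (hf j hj) _))

lemma Icc_one_filter_le {m n : ℕ} (hm : 1 ≤ m) : {k ∈ Icc 1 n | m ≤ k} = Icc m n := by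
  ext k; simp only [mem_filter, mem_Icc]; omega

lemma Icc_one_filter_ge {m n : ℕ} (hm : m ≤ n) : {k ∈ Icc 1 n | k ≤ m} = Icc 1 m := by
  ext k; simp only [mem_filter, mem_Icc]; omega

/-- Weighted Hardy inequality for tails. -/
lemma hardy_tail {α p : ℝ} (hα : 0 < α) (hp : 1 ≤ p) :
    ∃ C : ℝ, 0 < C ∧ ∀ (b : ℕ → ℝ) (n : ℕ), (∀ k ∈ Icc 1 n, 0 ≤ b k) →
      ∑ m ∈ Icc 1 n, (m : ℝ) ^ (α - 1) * (∑ k ∈ Icc m n, b k) ^ p ≤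
        C * ∑ m ∈ Icc 1 n, (m : ℝ) ^ (α - 1) * (b m * m) ^ p := by
  have hp0 : 0 < p := by linarith
  -- With δ = α / p, the exponent α - 1 - δ (p - 1) arising in the second Schur condition is exactly
  -- δ - 1.
  obtain ⟨δ, hδ, hδα⟩ : ∃ δ : ℝ, 0 < δ ∧ δ * p = α :=
    ⟨α / p, by positivity, div_mul_cancel₀ _ hp0.ne'⟩
  set B : ℝ := 2 * ((1 + δ) / δ) with hB
  set A : ℝ := (1 + δ) / δ with hA
  have hA0 : 0 < A := by positivity
  have hB0 : 0 < B := by positivity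
  refine ⟨B ^ (p - 1) * A, by positivity, fun b n hb => ?_⟩
  have hpos : ∀ m ∈ Icc 1 n, (0 : ℝ) < m := fun m hm => by
    exact_mod_cast (mem_Icc.1 hm).1
  have H := sum_mul_sum_filter_rpow_le (Icc 1 n) (fun i j => i ≤ j) hp
    (x := fun m => (m : ℝ) ^ (α - 1)) (y := fun k => (k : ℝ) ^ (-1 - δ))
    (f := fun k => (k : ℝ) ^ (1 + δ) * b k) (Y := fun m => B * (m : ℝ) ^ (-δ))
    (Z := fun k => B ^ (p - 1) * (A * (k : ℝ) ^ δ))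
    (fun i _ => by positivity) (fun i _ => by positivity)
    (fun i hi => mul_nonneg (by positivity) (hb i hi))
    (fun i hi => by
      rw [Icc_one_filter_le (mem_Icc.1 hi).1]
      exact sum_Icc_rpow_neg_le hδ (mem_Icc.1 hi).1 n)
    (fun j hj => by
      rw [Icc_one_filter_ge (mem_Icc.1 hj).2]
      have : ∀ i ∈ Icc 1 j, (i : ℝ) ^ (α - 1) * (B * (i : ℝ) ^ (-δ)) ^ (p - 1)
          = B ^ (p - 1) * (i : ℝ) ^ (δ - 1) := fun i hi => by
        have hi0 : (0 : ℝ) < i := by exact_mod_cast (mem_Icc.1 hi).1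
        rw [Real.mul_rpow hB0.le (by positivity), ← Real.rpow_mul hi0.le, mul_left_comm,
          ← Real.rpow_add hi0]
        congr 2; rw [← hδα]; ring
      rw [sum_congr rfl this, ← mul_sum]
      gcongr
      exact sum_Icc_one_rpow_le hδ j)
  calc _ = _ := sum_congr rfl fun m hm => by
        rw [← Icc_one_filter_le (mem_Icc.1 hm).1]
        congr 2
        refine sum_congr rfl fun k hk => ?_
        have hk0 := hpos k (mem_filter.1 hk).1
        rw [← mul_assoc, ← Real.rpow_add hk0]
        simp
    _ ≤ _ := H
    _ = _ := by
        rw [mul_sum]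
        refine sum_congr rfl fun k hk => ?_
        have hk0 := hpos k hk
        have hbk := hb k hk
        rw [Real.mul_rpow (by positivity) hbk, Real.mul_rpow hbk hk0.le, ← Real.rpow_mul hk0.le]
        have : (k : ℝ) ^ δ * ((k : ℝ) ^ (-1 - δ) * (k : ℝ) ^ ((1 + δ) * p))
            = (k : ℝ) ^ (α - 1) * (k : ℝ) ^ p := by
          rw [← Real.rpow_add hk0, ← Real.rpow_add hk0, ← Real.rpow_add hk0, ← hδα]
          congr 1; ring
        linear_combination (B ^ (p - 1) * A * b k ^ p) * this

/-- Weighted Hardy inequality for initial sums. -/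
lemma hardy_initial {α p : ℝ} (hα : 0 < α) (hp : 1 ≤ p) :
    ∃ C : ℝ, 0 < C ∧ ∀ (b : ℕ → ℝ) (n : ℕ), (∀ k ∈ Icc 1 n, 0 ≤ b k) →
      ∑ m ∈ Icc 1 n, (m : ℝ) ^ (-α - 1) * (∑ k ∈ Icc 1 m, b k) ^ p ≤
        C * ∑ m ∈ Icc 1 n, (m : ℝ) ^ (-α - 1) * (b m * m) ^ p := by
  have hp0 : 0 < p := by linarith
  obtain ⟨δ, hδ, hδα⟩ : ∃ δ : ℝ, 0 < δ ∧ δ * p = α :=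
    ⟨α / p, by positivity, div_mul_cancel₀ _ hp0.ne'⟩
  set B : ℝ := 2 * ((1 + δ) / δ) with hB
  set A : ℝ := (1 + δ) / δ with hA
  have hA0 : 0 < A := by positivity
  have hB0 : 0 < B := by positivity
  refine ⟨A ^ (p - 1) * B, by positivity, fun b n hb => ?_⟩
  have hpos : ∀ m ∈ Icc 1 n, (0 : ℝ) < m := fun m hm => by
    exact_mod_cast (mem_Icc.1 hm).1
  -- Dual to the tail case: the two power-sum estimates exchange roles.
  have H := sum_mul_sum_filter_rpow_le (Icc 1 n) (fun i j => j ≤ i) hp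
    (x := fun m => (m : ℝ) ^ (-α - 1)) (y := fun k => (k : ℝ) ^ (δ - 1))
    (f := fun k => (k : ℝ) ^ (1 - δ) * b k) (Y := fun m => A * (m : ℝ) ^ δ)
    (Z := fun k => A ^ (p - 1) * (B * (k : ℝ) ^ (-δ)))
    (fun i _ => by positivity) (fun i _ => by positivity)
    (fun i hi => mul_nonneg (by positivity) (hb i hi))
    (fun i hi => by
      rw [Icc_one_filter_ge (mem_Icc.1 hi).2]
      exact sum_Icc_one_rpow_le hδ i)
    (fun j hj => by
      rw [Icc_one_filter_le (mem_Icc.1 hj).1]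
      have : ∀ i ∈ Icc j n, (i : ℝ) ^ (-α - 1) * (A * (i : ℝ) ^ δ) ^ (p - 1)
          = A ^ (p - 1) * (i : ℝ) ^ (-1 - δ) := fun i hi => by
        have hi0 : (0 : ℝ) < i := (hpos j hj).trans_le (by exact_mod_cast (mem_Icc.1 hi).1)
        rw [Real.mul_rpow hA0.le (by positivity), ← Real.rpow_mul hi0.le, mul_left_comm,
          ← Real.rpow_add hi0]
        congr 2; rw [← hδα]; ring
      rw [sum_congr rfl this, ← mul_sum]
      gcongr
      exact sum_Icc_rpow_neg_le hδ (mem_Icc.1 hj).1 n)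
  calc _ = _ := sum_congr rfl fun m hm => by
        rw [← Icc_one_filter_ge (mem_Icc.1 hm).2]
        congr 2
        refine sum_congr rfl fun k hk => ?_
        have hk0 := hpos k (mem_filter.1 hk).1
        rw [← mul_assoc, ← Real.rpow_add hk0]
        simp
    _ ≤ _ := H
    _ = _ := by
        rw [mul_sum]
        refine sum_congr rfl fun k hk => ?_
        have hk0 := hpos k hk
        have hbk := hb k hk
        rw [Real.mul_rpow (by positivity) hbk, Real.mul_rpow hbk hk0.le, ← Real.rpow_mul hk0.le]
        have : (k : ℝ) ^ (-δ) * ((k : ℝ) ^ (δ - 1) * (k : ℝ) ^ ((1 - δ) * p))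
            = (k : ℝ) ^ (-α - 1) * (k : ℝ) ^ p := by
          rw [← Real.rpow_add hk0, ← Real.rpow_add hk0, ← Real.rpow_add hk0, ← hδα]
          congr 1; ring
        linear_combination (A ^ (p - 1) * B * b k ^ p) * this

/-! ### Lower bounds from monotonicity -/

lemma rpow_le_two_rpow_abs_mul {x y : ℝ} (r : ℝ) (hx : 0 < x) (hxy : x ≤ y) (hyx : y ≤ 2 * x) :
    y ^ r ≤ 2 ^ |r| * x ^ r := by
  rcases le_total 0 r with h | h
  · rw [abs_of_nonneg h, ← Real.mul_rpow (by norm_num) hx.le]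
    exact Real.rpow_le_rpow (hx.le.trans hxy) hyx h
  · have h1 : (1 : ℝ) ≤ 2 ^ |r| := Real.one_le_rpow (by norm_num) (abs_nonneg r)
    have h2 := Real.rpow_le_rpow_of_nonpos hx hxy h
    exact h2.trans (le_mul_of_one_le_left (by positivity) h1)

namespace NonnegDecreasing

variable {a : ℕ → ℝ}

lemma apply_le (ha : NonnegDecreasing a) {k m : ℕ} (hk : 1 ≤ k) (hkm : k ≤ m) : a m ≤ a k := by
  induction m, hkm using Nat.le_induction with
  | base => exact le_rfl
  | succ m hm ih => exact ((ha m (hk.trans hm)).2).trans ih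

/-- The upper half of the block `[1, m]` already carries the size `a m * m ^ (r + 1)`. -/
lemma le_sum_upper_half (ha : NonnegDecreasing a) (r : ℝ) {m : ℕ} (hm : 1 ≤ m) :
    a m * (m : ℝ) ^ (r + 1) ≤
      2 * 2 ^ |r| * ∑ k ∈ Icc ((m + 1) / 2) m, a k * (k : ℝ) ^ r := by
  have hm0 : (0 : ℝ) < m := by exact_mod_cast hm
  have ham := (ha m hm).1
  -- Rounding up gives m ≤ 2k and k ≥ 1 throughout the block, even for m = 1.
  have term : ∀ k ∈ Icc ((m + 1) / 2) m, a m * (m : ℝ) ^ r ≤ 2 ^ |r| * (a k * (k : ℝ) ^ r) := by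
    intro k hk
    obtain ⟨hk1, hk2⟩ := mem_Icc.1 hk
    have hk0 : 1 ≤ k := by omega
    calc a m * (m : ℝ) ^ r ≤ a k * (2 ^ |r| * (k : ℝ) ^ r) :=
          mul_le_mul (ha.apply_le hk0 hk2)
            (rpow_le_two_rpow_abs_mul r (by exact_mod_cast hk0) (by exact_mod_cast hk2)
              (by exact_mod_cast (by omega : m ≤ 2 * k)))
            (by positivity) (ha k hk0).1
      _ = _ := by ring
  have H := card_nsmul_le_sum _ _ _ term
  rw [← mul_sum, Nat.card_Icc, nsmul_eq_mul] at H
  have hc : (m : ℝ) ≤ 2 * ((m + 1 - (m + 1) / 2 : ℕ) : ℝ) := by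
    exact_mod_cast (by omega : m ≤ 2 * (m + 1 - (m + 1) / 2))
  calc a m * (m : ℝ) ^ (r + 1) = m * (a m * (m : ℝ) ^ r) := by
        rw [Real.rpow_add_one hm0.ne']; ring
    _ ≤ 2 * ((m + 1 - (m + 1) / 2 : ℕ) : ℝ) * (a m * (m : ℝ) ^ r) := by gcongr
    _ ≤ _ := by linarith

end NonnegDecreasing

/-- The fibre of m ↦ ⌈m/2⌉ over k is contained in {2k - 1, 2k}. -/
lemma sum_comp_half_le {f : ℕ → ℝ} {n : ℕ} (hf : ∀ k ∈ Icc 1 n, 0 ≤ f k) :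
    ∑ m ∈ Icc 1 n, f ((m + 1) / 2) ≤ 2 * ∑ k ∈ Icc 1 n, f k := by
  have hmaps : ∀ m ∈ Icc 1 n, (m + 1) / 2 ∈ Icc 1 n := fun m hm => by
    rw [mem_Icc] at *; omega
  rw [← sum_fiberwise_of_maps_to hmaps, mul_sum]
  refine sum_le_sum fun k hk => ?_
  have hsub : {m ∈ Icc 1 n | (m + 1) / 2 = k} ⊆ {2 * k - 1, 2 * k} := fun m hm => by
    simp only [mem_filter, mem_Icc, mem_insert, mem_singleton] at *; omega
  have hcard : (#{m ∈ Icc 1 n | (m + 1) / 2 = k} : ℝ) ≤ 2 := by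
    exact_mod_cast (card_le_card hsub).trans card_le_two
  rw [sum_congr rfl fun m hm => by rw [(mem_filter.1 hm).2], sum_const, nsmul_eq_mul]
  exact mul_le_mul_of_nonneg_right hcard (hf k hk)

theorem corollary5p2 (α lam p : ℝ) (hα : 0 < α) (hp : 1 ≤ p) :
    (∃ c C : ℝ, 0 < c ∧ 0 < C ∧
      ∀ a : ℕ → ℝ, NonnegDecreasing a → ∀ n : ℕ, 1 ≤ n →
        c * ∑ μ ∈ Finset.Icc 1 n, (μ : ℝ) ^ (α - 1) * (a μ * (μ : ℝ) ^ (lam + 1)) ^ p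
            ≤ ∑ μ ∈ Finset.Icc 1 n,
                (μ : ℝ) ^ (α - 1) * (∑ ν ∈ Finset.Icc μ n, a ν * (ν : ℝ) ^ lam) ^ p ∧
        ∑ μ ∈ Finset.Icc 1 n,
            (μ : ℝ) ^ (α - 1) * (∑ ν ∈ Finset.Icc μ n, a ν * (ν : ℝ) ^ lam) ^ p
          ≤ C * ∑ μ ∈ Finset.Icc 1 n, (μ : ℝ) ^ (α - 1) * (a μ * (μ : ℝ) ^ (lam + 1)) ^ p) ∧
    (∃ c C : ℝ, 0 < c ∧ 0 < C ∧
      ∀ a : ℕ → ℝ, NonnegDecreasing a → ∀ n : ℕ, 1 ≤ n →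
        c * ∑ μ ∈ Finset.Icc 1 n, (μ : ℝ) ^ (-α - 1) * (a μ * (μ : ℝ) ^ (lam + 1)) ^ p
            ≤ ∑ μ ∈ Finset.Icc 1 n,
                (μ : ℝ) ^ (-α - 1) * (∑ ν ∈ Finset.Icc 1 μ, a ν * (ν : ℝ) ^ lam) ^ p ∧
        ∑ μ ∈ Finset.Icc 1 n,
            (μ : ℝ) ^ (-α - 1) * (∑ ν ∈ Finset.Icc 1 μ, a ν * (ν : ℝ) ^ lam) ^ p
          ≤ C * ∑ μ ∈ Finset.Icc 1 n,
              (μ : ℝ) ^ (-α - 1) * (a μ * (μ : ℝ) ^ (lam + 1)) ^ p) := by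
  have hp0 : 0 ≤ p := by linarith
  have hshift : ∀ (a : ℕ → ℝ) (n : ℕ) (β : ℝ),
      ∑ m ∈ Icc 1 n, (m : ℝ) ^ β * (a m * (m : ℝ) ^ lam * m) ^ p
        = ∑ m ∈ Icc 1 n, (m : ℝ) ^ β * (a m * (m : ℝ) ^ (lam + 1)) ^ p := by
    intro a n β
    refine sum_congr rfl fun m hm => ?_
    have hm0 : (m : ℝ) ≠ 0 := by
      have := (mem_Icc.1 hm).1
      exact_mod_cast (by omega : m ≠ 0)
    rw [Real.rpow_add_one hm0, mul_assoc]
  have hterm : ∀ a : ℕ → ℝ, NonnegDecreasing a → ∀ k, 1 ≤ k → 0 ≤ a k * (k : ℝ) ^ lam :=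
    fun a ha k hk => mul_nonneg (ha k hk).1 (by positivity)
  set d : ℝ := 2 * 2 ^ |lam| with hd
  have hd0 : 0 < d := by positivity
  have hsub : ∀ a : ℕ → ℝ, NonnegDecreasing a → ∀ (m : ℕ) (t : Finset ℕ), 1 ≤ m →
      Icc ((m + 1) / 2) m ⊆ t → (∀ k ∈ t, 1 ≤ k) →
      (a m * (m : ℝ) ^ (lam + 1)) ^ p ≤ d ^ p * (∑ k ∈ t, a k * (k : ℝ) ^ lam) ^ p := by
    intro a ha m t hm ht ht1
    rw [← Real.mul_rpow hd0.le (sum_nonneg fun k hk => hterm a ha k (ht1 k hk))]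
    refine Real.rpow_le_rpow (mul_nonneg (ha m hm).1 (by positivity)) ?_ hp0
    refine (ha.le_sum_upper_half lam hm).trans ?_
    gcongr
    exact fun k hk _ => hterm a ha k (ht1 k hk)
  constructor
  · obtain ⟨C, hC, hardy⟩ := hardy_tail hα hp
    set D : ℝ := 2 ^ |α - 1| * d ^ p with hD
    have hD0 : 0 < D := by positivity
    -- `D` is the cost of passing from term m to term ⌈m/2⌉; the 2 counts the fibres.
    refine ⟨(2 * D)⁻¹, C, by positivity, hC, fun a ha n _ => ⟨?_, ?_⟩⟩
    · rw [inv_mul_le_iff₀ (by positivity)]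
      have hT : ∀ k ∈ Icc 1 n, 0 ≤
          (k : ℝ) ^ (α - 1) * (∑ ν ∈ Icc k n, a ν * (ν : ℝ) ^ lam) ^ p := fun k hk =>
        mul_nonneg (by positivity) (Real.rpow_nonneg (sum_nonneg fun j hj =>
          hterm a ha j ((mem_Icc.1 hk).1.trans (mem_Icc.1 hj).1)) _)
      have hhalf := sum_comp_half_le hT
      calc _ ≤ ∑ m ∈ Icc 1 n, D * ((((m + 1) / 2 : ℕ) : ℝ) ^ (α - 1) *
            (∑ ν ∈ Icc ((m + 1) / 2) n, a ν * (ν : ℝ) ^ lam) ^ p) := by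
            refine sum_le_sum fun m hm => ?_
            obtain ⟨hm1, hmn⟩ := mem_Icc.1 hm
            have hk1 : 1 ≤ (m + 1) / 2 := by omega
            have h1 := rpow_le_two_rpow_abs_mul (x := (((m + 1) / 2 : ℕ) : ℝ)) (y := m) (α - 1)
              (by exact_mod_cast hk1) (by exact_mod_cast (by omega : (m + 1) / 2 ≤ m))
              (by exact_mod_cast (by omega : m ≤ 2 * ((m + 1) / 2)))
            have h2 := hsub a ha m (Icc ((m + 1) / 2) n) hm1 (Icc_subset_Icc le_rfl hmn)
              fun k hk => hk1.trans (mem_Icc.1 hk).1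
            calc _ ≤ _ := mul_le_mul h1 h2
                  (Real.rpow_nonneg (mul_nonneg (ha m hm1).1 (by positivity)) _) (by positivity)
              _ = _ := by rw [hD]; ring
        _ ≤ D * (2 * ∑ k ∈ Icc 1 n,
            (k : ℝ) ^ (α - 1) * (∑ ν ∈ Icc k n, a ν * (ν : ℝ) ^ lam) ^ p) := by
            rw [← mul_sum]; gcongr
        _ = _ := by ring
    · rw [← hshift]
      exact hardy _ n fun k hk => hterm a ha k (mem_Icc.1 hk).1
  · obtain ⟨C, hC, hardy⟩ := hardy_initial hα hp
    refine ⟨(d ^ p)⁻¹, C, by positivity, hC, fun a ha n _ => ⟨?_, ?_⟩⟩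
    · rw [inv_mul_le_iff₀ (by positivity), mul_sum]
      refine sum_le_sum fun m hm => ?_
      have hm1 := (mem_Icc.1 hm).1
      have h := hsub a ha m (Icc 1 m) hm1 (Icc_subset_Icc (by omega) le_rfl)
        fun k hk => (mem_Icc.1 hk).1
      calc _ ≤ _ := mul_le_mul_of_nonneg_left h (by positivity)
        _ = _ := by ring
    · rw [← hshift]
      exact hardy _ n fun k hk => hterm a ha k (mem_Icc.1 hk).1
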